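/- Let $d\in\mathbb{N}$ and for $x\in\mathbb{R}^d$ or $x\in\mathbb{C}^d$ write $x^2=x_1^2+\cdots+x_d^2$ (without complex conjugation). Let $\rho(x)=(2\pi)^{-d/2}e^{-x^2/2}$ be the standard Gaussian density on $\mathbb{R}^d$, extended to $\mathbb{C}^d$ by the same formula, and let $L^p(\mathbb{R}^d,\rho)$ denote the space of (classes of) complex-valued functions that are $p$-integrable with respect to the measure $\rho(x)\,dx$. For $1<p<\infty$ and $f\in L^p(\mathbb{R}^d,\rho)$, the Segal--Bargmann transform of $f$ is \[ Sf(z)=\int_{\mathbb{R}^d}\rho(z-x)f(x)\,dx=(2\pi)^{-d/2}\int_{\mathbb{R}^d}e^{-(z-x)^2/2}f(x)\,dx,\qquad z\in\mathbb{C}^d . \] Theorem. Fix $p$ with $1<p<\infty$. Suppose that $F$ is a holomorphic function on $\mathbb{C}^d$ such that \[ \int_{\mathbb{R}^d}\left(\int_{\mathbb{R}^d}|F(x+iy)|\,e^{-y^2/2}\,e^{-x^2/(2(p-1))}\,dy\right)^{p}dx<\infty . \] Then there exists a unique $f\in L^p(\mathbb{R}^d,\rho)$ such that $Sf(z)=F(z)$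 for all $z\in\mathbb{C}^d$. -/

import Mathlib

open MeasureTheory

noncomputable section

/-- The point `x + iy` of `ℂ^d`, for `x, y ∈ ℝ^d`. -/
def complexPoint {d : ℕ} (x y : EuclideanSpace ℝ (Fin d)) : EuclideanSpace ℂ (Fin d) :=
  WithLp.toLp 2 (fun j => (x j : ℂ) + (y j : ℂ) * Complex.I)

/-- The standard Gaussian density `ρ(x) = (2π)^{-d/2} e^{-x²/2}` on `ℝ^d`,
where `x² = x₁² + ⋯ + x_d²`. -/
def gaussianDensity {d : ℕ} (x : EuclideanSpace ℝ (Fin d)) : ℝ :=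
  (2 * Real.pi) ^ (-(d : ℝ) / 2) * Real.exp (-(∑ j, x j ^ 2) / 2)

/-- The Gaussian measure `ρ(x) dx` on `ℝ^d`. -/
def gaussianRho (d : ℕ) : Measure (EuclideanSpace ℝ (Fin d)) :=
  volume.withDensity (fun x => ENNReal.ofReal (gaussianDensity x))

/-- The entire analytic continuation of the Gaussian density to `ℂ^d`:
`ρ(z) = (2π)^{-d/2} e^{-z²/2}` with `z² = z₁² + ⋯ + z_d²` (no complex conjugates). -/
def gaussianDensityC {d : ℕ} (z : EuclideanSpace ℂ (Fin d)) : ℂ :=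
  (((2 * Real.pi) ^ (-(d : ℝ) / 2) : ℝ) : ℂ) * Complex.exp (-(∑ j, z j ^ 2) / 2)

/-- The continuation agrees with the real density on `ℝ^d`. -/
theorem gaussianDensityC_real {d : ℕ} (x : EuclideanSpace ℝ (Fin d)) :
    gaussianDensityC (complexPoint x 0) = (gaussianDensity x : ℂ) := by
  simp [gaussianDensityC, gaussianDensity, complexPoint]

/-- The Segal-Bargmann transform `Sf(z) = ∫ ρ(z - x) f(x) dx`, `z ∈ ℂ^d`. -/
def segalBargmann {d : ℕ} (f : EuclideanSpace ℝ (Fin d) → ℂ)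
    (z : EuclideanSpace ℂ (Fin d)) : ℂ :=
  ∫ x : EuclideanSpace ℝ (Fin d), gaussianDensityC (z - complexPoint x 0) * f x

end

open scoped ContDiff FourierTransform

/-! Let `q` be the exponent conjugate to `p`. The inverse transform is explicit: f(u) = (2π)^{-d/2}
∫ e^{(z-u)²/2} F(z) dy over the fibre z = u/q + iy. On this fibre the kernel is bounded by
e^{q(q-1)|x|²/2} times the integrand of the hypothesis, and that growth is exactly what ρ absorbs in
L^p (`memLp_segalBargmannInv`).

To compute Sf(w), put u = qx. The integral runs over all of ℂ^d, and after translation by w its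
integrand is a radial Gaussian times an entire function whose value at 0 is F(w). The mean value
property (`integral_eq_of_gaussian_mul_differentiable`) then gives Sf = F; Hölder's inequality
justifies Fubini.

Uniqueness: on iℝ^d the transform is a Fourier transform of ρf up to a nonvanishing factor, hence
injective (`ae_eq_of_segalBargmann_eq`). -/

/-! ### Injectivity of the Fourier transform on L¹. -/

theorem ae_eq_zero_of_fourier_eq_zero {V : Type*} [NormedAddCommGroup V] [InnerProductSpace ℝ V]
    [FiniteDimensional ℝ V] [MeasurableSpace V] [BorelSpace V] {k : V → ℂ} (hk : Integrable k)
    (h : ∀ w, ∫ v, Complex.exp (-2 * Real.pi * inner ℝ v w * Complex.I) * k v = 0) :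
    k =ᵐ[volume] 0 := by
  have h0 : 𝓕 k = 0 := by
    ext w
    rw [Real.fourier_eq', Pi.zero_apply, ← h w]
    refine integral_congr_ae (Filter.Eventually.of_forall fun v => ?_)
    simp only [smul_eq_mul]
    push_cast
    rfl
  refine ae_eq_zero_of_integral_contDiff_smul_eq_zero hk.locallyIntegrable fun g hg hgc => ?_
  have hg₁ : HasCompactSupport (Complex.ofRealCLM ∘ g) := hgc.comp_left rfl
  have hg₂ : ContDiff ℝ ∞ (Complex.ofRealCLM ∘ g) := by fun_prop
  -- With 𝓕φ = g, moving the transform across the pairing gives ∫ g k = ∫ φ 𝓕k = 0.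
  let φ : SchwartzMap V ℂ := 𝓕⁻ (hg₁.toSchwartzMap hg₂)
  have hφ : ∀ x, 𝓕 (φ : V → ℂ) x = g x := fun x => by
    rw [← SchwartzMap.fourier_coe]
    simp [φ]
  have := VectorFourier.integral_fourierIntegral_smul_eq_flip (L := innerₗ V)
    Real.continuous_fourierChar continuous_inner (φ.integrable (μ := volume)) hk
  have e1 : ∀ x, VectorFourier.fourierIntegral Real.fourierChar volume (innerₗ V) φ x = g x := hφ
  have e2 : ∀ x, VectorFourier.fourierIntegral Real.fourierChar volume (innerₗ V).flip k x = 0 := by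
    intro x
    rw [flip_innerₗ]
    exact congrFun h0 x
  simp only [e1, e2, smul_zero, integral_zero] at this
  rw [← this]
  exact integral_congr_ae (Filter.Eventually.of_forall fun v => by simp)

/-! ### Multiplication by e^{iθ}, seen on pairs of real vectors. -/

section Rotation

variable {V : Type*} [NormedAddCommGroup V] [InnerProductSpace ℝ V]

/-- Rotation by the angle `θ` of each of the planes spanned by `(v, 0)` and `(0, v)`. -/
noncomputable def prodRotation (θ : ℝ) (w : V × V) : V × V :=
  (Real.cos θ • w.1 - Real.sin θ • w.2, Real.sin θ • w.1 + Real.cos θ • w.2)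

theorem norm_sq_prodRotation (θ : ℝ) (w : V × V) :
    ‖(prodRotation θ w).1‖ ^ 2 + ‖(prodRotation θ w).2‖ ^ 2 = ‖w.1‖ ^ 2 + ‖w.2‖ ^ 2 := by
  simp only [prodRotation]
  rw [norm_sub_sq_real, norm_add_sq_real]
  simp only [norm_smul, inner_smul_left, inner_smul_right, mul_pow, Real.norm_eq_abs, sq_abs]
  simp only [conj_trivial]
  linear_combination (‖w.1‖ ^ 2 + ‖w.2‖ ^ 2) * Real.sin_sq_add_cos_sq θ

theorem continuous_prodRotation : Continuous fun q : ℝ × (V × V) => prodRotation q.1 q.2 := by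
  unfold prodRotation
  fun_prop

variable [FiniteDimensional ℝ V] [MeasurableSpace V] [BorelSpace V]

theorem measurePreserving_prodRotation (θ : ℝ) :
    MeasurePreserving (prodRotation (V := V) θ) := by
  -- The plain product carries the sup norm, for which this map is no isometry; the L² product has
  -- the same volume and makes it one.
  let L : WithLp 2 (V × V) →ₗ[ℝ] WithLp 2 (V × V) :=
    { toFun := fun w => WithLp.toLp 2 (prodRotation θ (WithLp.ofLp w))
      map_add' := fun a b => by
        apply (WithLp.ofLp_injective 2)
        ext <;> simp [prodRotation, smul_add] <;> abel
      map_smul' := fun r a => by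
        apply (WithLp.ofLp_injective 2)
        ext <;> simp [prodRotation, smul_sub, smul_comm r] }
  have hL : ∀ w, ‖L w‖ = ‖w‖ := fun w => by
    rw [← sq_eq_sq₀ (norm_nonneg _) (norm_nonneg _), WithLp.prod_norm_sq_eq_of_L2,
      WithLp.prod_norm_sq_eq_of_L2]
    exact norm_sq_prodRotation θ (WithLp.ofLp w)
  let e := (⟨L, hL⟩ : WithLp 2 (V × V) →ₗᵢ[ℝ] WithLp 2 (V × V)).toLinearIsometryEquiv rfl
  exact ((WithLp.volume_preserving_ofLp V V).comp e.measurePreserving).comp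
    (WithLp.volume_preserving_toLp V V)

end Rotation

/-! ### Mean value property against a radial Gaussian. -/

theorem integral_circle_eq_of_differentiable {g : ℂ → ℂ} (hg : Differentiable ℂ g) :
    ∫ θ in (0 : ℝ)..2 * Real.pi, g (Complex.exp (θ * Complex.I)) = 2 * Real.pi * g 0 := by
  have := (hg.diffContOnCl (s := Metric.ball 0 |1|)).circleAverage
  rw [Real.circleAverage_def] at this
  simp only [circleMap_zero, Complex.ofReal_one, one_mul] at this
  rw [← this, Complex.real_smul]
  push_cast
  rw [mul_inv_cancel_left₀ (by simp [Real.pi_ne_zero])]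

section ComplexPoint

variable {d : ℕ}

local notation "𝔼" => EuclideanSpace ℝ (Fin d)

theorem continuous_complexPoint : Continuous fun v : 𝔼 × 𝔼 => complexPoint v.1 v.2 := by
  unfold complexPoint
  refine (PiLp.continuous_toLp 2 _).comp (continuous_pi fun j => ?_)
  fun_prop

theorem complexPoint_prodRotation (θ : ℝ) (v : 𝔼 × 𝔼) :
    complexPoint (prodRotation θ v).1 (prodRotation θ v).2 =
      Complex.exp (θ * Complex.I) • complexPoint v.1 v.2 := by
  ext j
  simp only [complexPoint, prodRotation, Complex.exp_mul_I, PiLp.smul_apply, PiLp.add_apply,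
    PiLp.sub_apply, smul_eq_mul]
  push_cast
  linear_combination (Complex.sin θ * v.2 j) * (-Complex.I_sq)

/-- Volume and weight are invariant under z ↦ e^{iθ}z, so the integrand may be averaged over θ. By
the one-variable mean value property of ζ ↦ G(ζz), the average replaces G by the constant G(0). -/
theorem integral_eq_of_gaussian_mul_differentiable {b : ℝ} (hb : 0 < b)
    {G : EuclideanSpace ℂ (Fin d) → ℂ} (hG : Differentiable ℂ G)
    (hint : Integrable fun v : 𝔼 × 𝔼 =>
      (Real.exp (-b * (‖v.1‖ ^ 2 + ‖v.2‖ ^ 2)) : ℂ) * G (complexPoint v.1 v.2)) :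
    ∫ v : 𝔼 × 𝔼, (Real.exp (-b * (‖v.1‖ ^ 2 + ‖v.2‖ ^ 2)) : ℂ) * G (complexPoint v.1 v.2) =
      ((Real.pi / b) ^ d : ℝ) * G 0 := by
  set Φ : 𝔼 × 𝔼 → ℂ := fun v =>
    (Real.exp (-b * (‖v.1‖ ^ 2 + ‖v.2‖ ^ 2)) : ℂ) * G (complexPoint v.1 v.2) with hΦ
  have hΦc : Continuous Φ := by
    have := hG.continuous.comp (continuous_complexPoint (d := d))
    simp only [Function.comp_def] at this
    exact (Complex.continuous_ofReal.comp (by fun_prop)).mul this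
  have hme : ∀ θ, ∫ v, Φ (prodRotation θ v) = ∫ v, Φ v := fun θ => by
    have h := (measurePreserving_prodRotation (V := 𝔼) θ)
    rw [← integral_map (f := Φ) h.measurable.aemeasurable hΦc.aestronglyMeasurable, h.map_eq]
  have hne : ∀ θ, ∫ v, ‖Φ (prodRotation θ v)‖ = ∫ v, ‖Φ v‖ := fun θ => by
    have h := (measurePreserving_prodRotation (V := 𝔼) θ)
    rw [← integral_map (f := fun v => ‖Φ v‖) h.measurable.aemeasurable
      hΦc.norm.aestronglyMeasurable, h.map_eq]
  have hI : Integrable (fun q : ℝ × (𝔼 × 𝔼) => Φ (prodRotation q.1 q.2))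
      ((volume.restrict (Set.uIoc 0 (2 * Real.pi))).prod volume) := by
    have hc : Continuous fun q : ℝ × (𝔼 × 𝔼) => Φ (prodRotation q.1 q.2) :=
      hΦc.comp continuous_prodRotation
    rw [integrable_prod_iff hc.aestronglyMeasurable]
    refine ⟨Filter.Eventually.of_forall fun θ =>
      (measurePreserving_prodRotation θ).integrable_comp_of_integrable hint, ?_⟩
    simp only [hne]
    refine integrable_const_iff.2 (Or.inr ⟨?_⟩)
    rw [Measure.restrict_apply_univ, Set.uIoc_of_le Real.two_pi_pos.le, Real.volume_Ioc]
    exact ENNReal.ofReal_lt_top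
  have key : (2 * Real.pi : ℂ) * ∫ v, Φ v =
      (2 * Real.pi : ℂ) * (((Real.pi / b) ^ d : ℝ) * G 0) := by
    calc (2 * Real.pi : ℂ) * ∫ v, Φ v
        = ∫ θ in (0 : ℝ)..2 * Real.pi, ∫ v, Φ (prodRotation θ v) := by
          simp [hme]
      _ = ∫ v, ∫ θ in (0 : ℝ)..2 * Real.pi, Φ (prodRotation θ v) :=
          intervalIntegral_integral_swap hI
      _ = ∫ v : 𝔼 × 𝔼, (Real.exp (-b * (‖v.1‖ ^ 2 + ‖v.2‖ ^ 2)) : ℂ) *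
            (2 * Real.pi * G 0) := by
          congr 1
          ext v
          simp only [hΦ, norm_sq_prodRotation, complexPoint_prodRotation]
          rw [intervalIntegral.integral_const_mul]
          congr 1
          have hd : Differentiable ℂ fun ζ : ℂ => G (ζ • complexPoint v.1 v.2) :=
            hG.comp (differentiable_id.smul_const _)
          simpa using integral_circle_eq_of_differentiable hd
      _ = _ := by
          rw [integral_mul_const]
          have : ∫ v : 𝔼 × 𝔼, (Real.exp (-b * (‖v.1‖ ^ 2 + ‖v.2‖ ^ 2)) : ℂ) =
              ((Real.pi / b) ^ d : ℝ) := by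
            rw [integral_complex_ofReal]
            congr 1
            simp only [mul_add, Real.exp_add]
            rw [show (volume : Measure (𝔼 × 𝔼)) = volume.prod volume from rfl,
              integral_prod_mul (fun x : 𝔼 => Real.exp (-b * ‖x‖ ^ 2))
                (fun x : 𝔼 => Real.exp (-b * ‖x‖ ^ 2)),
              GaussianFourier.integral_rexp_neg_mul_sq_norm hb, finrank_euclideanSpace_fin,
              ← Real.rpow_add (by positivity), add_halves, Real.rpow_natCast]
          rw [this]
          ring
  exact mul_left_cancel₀ (by simp [Real.pi_ne_zero]) key

end ComplexPoint

/-! ### The complex Gaussian, and uniqueness. -/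

section GaussianDensity

variable {d : ℕ}

local notation "𝔼" => EuclideanSpace ℝ (Fin d)

theorem gaussianDensity_eq (x : 𝔼) :
    gaussianDensity x = (2 * Real.pi) ^ (-(d : ℝ) / 2) * Real.exp (-‖x‖ ^ 2 / 2) := by
  rw [gaussianDensity, EuclideanSpace.real_norm_sq_eq]

theorem gaussianDensity_pos (x : 𝔼) : 0 < gaussianDensity x := by
  rw [gaussianDensity_eq]
  positivity

theorem continuous_gaussianDensity : Continuous (gaussianDensity (d := d)) := by
  simp only [funext gaussianDensity_eq]
  fun_prop

theorem continuous_gaussianDensityC : Continuous (gaussianDensityC (d := d)) := by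
  unfold gaussianDensityC
  fun_prop

theorem exists_eq_complexPoint (z : EuclideanSpace ℂ (Fin d)) :
    ∃ a b : 𝔼, z = complexPoint a b :=
  ⟨WithLp.toLp 2 fun j => (z j).re, WithLp.toLp 2 fun j => (z j).im, by
    ext j
    simp [complexPoint]⟩

theorem sum_sq_complexPoint (x y : 𝔼) :
    ∑ j, complexPoint x y j ^ 2 =
      ((‖x‖ ^ 2 - ‖y‖ ^ 2 : ℝ) : ℂ) + 2 * (inner ℝ x y : ℝ) * Complex.I := by
  rw [EuclideanSpace.real_norm_sq_eq, EuclideanSpace.real_norm_sq_eq, PiLp.inner_apply]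
  push_cast
  rw [Finset.mul_sum, Finset.sum_mul, ← Finset.sum_sub_distrib, ← Finset.sum_add_distrib]
  refine Finset.sum_congr rfl fun j _ => ?_
  simp [complexPoint]
  linear_combination (y j : ℂ) ^ 2 * Complex.I_sq

theorem complexPoint_sub (a b x y : 𝔼) :
    complexPoint a b - complexPoint x y = complexPoint (a - x) (b - y) := by
  ext j
  simp [complexPoint]
  ring

theorem complexPoint_add (a b x y : 𝔼) :
    complexPoint a b + complexPoint x y = complexPoint (a + x) (b + y) := by
  ext j
  simp [complexPoint]
  ring

theorem gaussianDensityC_complexPoint (x y : 𝔼) :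
    gaussianDensityC (complexPoint x y) =
      (Real.exp (‖y‖ ^ 2 / 2) * gaussianDensity x : ℝ) *
        Complex.exp (-(inner ℝ x y : ℝ) * Complex.I) := by
  rw [gaussianDensityC, sum_sq_complexPoint, gaussianDensity_eq]
  push_cast
  rw [mul_left_comm, mul_assoc, mul_assoc, ← Complex.exp_add, ← Complex.exp_add]
  congr 2
  ring

theorem norm_gaussianDensityC_complexPoint (x y : 𝔼) :
    ‖gaussianDensityC (complexPoint x y)‖ = Real.exp (‖y‖ ^ 2 / 2) * gaussianDensity x := by
  rw [gaussianDensityC_complexPoint, norm_mul, Complex.norm_real, ← Complex.ofReal_neg,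
    Complex.norm_exp_ofReal_mul_I, mul_one, Real.norm_of_nonneg]
  exact mul_nonneg (Real.exp_nonneg _) (gaussianDensity_pos x).le

theorem integrable_rexp_neg_mul_sq_norm_add {b : ℝ} (hb : 0 < b) (c : ℝ) (w : 𝔼) :
    Integrable fun v : 𝔼 => Real.exp (-b * ‖v‖ ^ 2 + c * inner ℝ w v) := by
  have := (GaussianFourier.integrable_cexp_neg_mul_sq_norm_add (b := b)
    (by simpa using hb) (c : ℂ) w).norm
  refine this.congr (Filter.Eventually.of_forall fun v => ?_)
  simp only [Complex.norm_exp]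
  norm_cast

instance isFiniteMeasure_gaussianRho : IsFiniteMeasure (gaussianRho d) := by
  refine isFiniteMeasure_withDensity_ofReal (Integrable.hasFiniteIntegral ?_)
  refine ((integrable_rexp_neg_mul_sq_norm_add (d := d) one_half_pos 0 0).const_mul
    ((2 * Real.pi) ^ (-(d : ℝ) / 2))).congr (Filter.Eventually.of_forall fun v => ?_)
  simp only [gaussianDensity_eq]
  congr 2
  ring

theorem measurable_ofReal_gaussianDensity :
    Measurable fun x : 𝔼 => ENNReal.ofReal (gaussianDensity x) :=
  continuous_gaussianDensity.measurable.ennreal_ofReal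

theorem ae_gaussianRho_iff {P : 𝔼 → Prop} :
    (∀ᵐ x ∂gaussianRho d, P x) ↔ ∀ᵐ x : 𝔼, P x := by
  rw [gaussianRho, ae_withDensity_iff measurable_ofReal_gaussianDensity]
  simp [gaussianDensity_pos]

theorem segalBargmann_congr_ae {f g : 𝔼 → ℂ} (h : f =ᵐ[gaussianRho d] g)
    (z : EuclideanSpace ℂ (Fin d)) : segalBargmann f z = segalBargmann g z := by
  refine integral_congr_ae ?_
  filter_upwards [ae_gaussianRho_iff.1 h] with x hx
  rw [hx]

theorem integrable_gaussianDensity_mul {f : 𝔼 → ℂ} (hf : Integrable f (gaussianRho d)) :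
    Integrable fun x : 𝔼 => (gaussianDensity x : ℂ) * f x := by
  rw [gaussianRho, integrable_withDensity_iff_integrable_smul' measurable_ofReal_gaussianDensity
    (Filter.Eventually.of_forall fun _ => ENNReal.ofReal_lt_top)] at hf
  refine hf.congr (Filter.Eventually.of_forall fun x => ?_)
  simp [ENNReal.toReal_ofReal (gaussianDensity_pos x).le]

theorem segalBargmann_imaginary (f : 𝔼 → ℂ) (b : 𝔼) :
    segalBargmann f (complexPoint 0 b) = (Real.exp (‖b‖ ^ 2 / 2) : ℂ) *
      ∫ x : 𝔼, Complex.exp ((inner ℝ x b : ℝ) * Complex.I) * ((gaussianDensity x : ℂ) * f x) := by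
  rw [segalBargmann, ← integral_const_mul]
  congr 1
  ext x
  rw [complexPoint_sub, gaussianDensityC_complexPoint, zero_sub, sub_zero, inner_neg_left]
  simp only [gaussianDensity_eq, norm_neg]
  push_cast
  rw [neg_neg]
  ring

theorem ae_eq_of_segalBargmann_eq {f g : 𝔼 → ℂ} (hf : Integrable f (gaussianRho d))
    (hg : Integrable g (gaussianRho d)) (h : ∀ z, segalBargmann f z = segalBargmann g z) :
    f =ᵐ[gaussianRho d] g := by
  have hf' := integrable_gaussianDensity_mul hf
  have hg' := integrable_gaussianDensity_mul hg
  have key := ae_eq_zero_of_fourier_eq_zero (hf'.sub hg') fun w => by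
    have hc : ∀ k : 𝔼 → ℂ, Integrable k → Integrable fun x =>
        Complex.exp ((inner ℝ x ((-2 * Real.pi) • w) : ℝ) * Complex.I) * k x := fun k hk => by
      refine hk.bdd_mul (c := 1) (Continuous.aestronglyMeasurable (by fun_prop)) ?_
      exact Filter.Eventually.of_forall fun x => (Complex.norm_exp_ofReal_mul_I _).le
    -- The factor -2π matches the normalisation of the Fourier kernel.
    have hz := h (complexPoint 0 ((-2 * Real.pi) • w))
    rw [segalBargmann_imaginary, segalBargmann_imaginary] at hz
    have hz' := sub_eq_zero.2 (mul_left_cancel₀ (by simp) hz)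
    rw [← integral_sub (hc _ hf') (hc _ hg')] at hz'
    rw [← hz']
    congr 1
    ext x
    rw [inner_smul_right]
    simp only [Pi.sub_apply]
    push_cast
    ring
  rw [Filter.EventuallyEq, ae_gaussianRho_iff]
  filter_upwards [key] with x hx
  have hx' : (gaussianDensity x : ℂ) * f x - gaussianDensity x * g x = 0 := hx
  exact mul_left_cancel₀ (by exact_mod_cast (gaussianDensity_pos x).ne') (sub_eq_zero.1 hx')

end GaussianDensity

/-! ### The inversion formula, and existence. -/

section Inversion

variable {d : ℕ}

local notation "𝔼" => EuclideanSpace ℝ (Fin d)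

/-- The integrand `e^{(z - q x)² / 2} F(z)`, `z = x + iy`, whose integral over the vertical fibre
at `x` recovers the inverse Segal-Bargmann transform of `F` at the point `q x`. -/
noncomputable def inversionKernel (q : ℝ) (F : EuclideanSpace ℂ (Fin d) → ℂ) (x y : 𝔼) : ℂ :=
  Complex.exp ((∑ j, complexPoint ((1 - q) • x) y j ^ 2) / 2) * F (complexPoint x y)

/-- The inverse Segal-Bargmann transform, by integration over the fibre at `u / q`. -/
noncomputable def segalBargmannInv (q : ℝ) (F : EuclideanSpace ℂ (Fin d) → ℂ) (u : 𝔼) : ℂ :=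
  ((2 * Real.pi) ^ (-(d : ℝ) / 2) : ℝ) * ∫ y : 𝔼, inversionKernel q F (q⁻¹ • u) y

variable {p q : ℝ} {F : EuclideanSpace ℂ (Fin d) → ℂ}

theorem continuous_inversionKernel (hF : Continuous F) :
    Continuous fun v : 𝔼 × 𝔼 => inversionKernel q F v.1 v.2 := by
  unfold inversionKernel
  have h1 : Continuous fun v : 𝔼 × 𝔼 => complexPoint ((1 - q) • v.1) v.2 :=
    continuous_complexPoint.comp (f := fun v : 𝔼 × 𝔼 => ((1 - q) • v.1, v.2)) (by fun_prop)
  have h2 := hF.comp (continuous_complexPoint (d := d))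
  exact (Complex.continuous_exp.comp ((continuous_finsetSum _ fun j _ =>
    ((EuclideanSpace.proj (𝕜 := ℂ) j).continuous.comp h1).pow 2).div_const 2)).mul h2

/-- Uses (1-q)² = q(q-1) - (q-1) and q-1 = 1/(p-1): the second term is the Gaussian weight in x of
the hypothesis. -/
theorem enorm_inversionKernel (hpq : p.HolderConjugate q) (x y : 𝔼) :
    ‖inversionKernel q F x y‖ₑ = ENNReal.ofReal (Real.exp (q * (q - 1) / 2 * ‖x‖ ^ 2)) *
      ENNReal.ofReal (‖F (complexPoint x y)‖ * Real.exp (-(∑ j, y j ^ 2) / 2) *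
          Real.exp (-(∑ j, x j ^ 2) / (2 * (p - 1)))) := by
  have hp1 : p - 1 ≠ 0 := hpq.sub_one_ne_zero
  have hq : (q - 1) * (p - 1) = 1 := by linarith [hpq.mul_eq_add]
  have hre : ((∑ j, complexPoint ((1 - q) • x) y j ^ 2) / 2).re =
      q * (q - 1) / 2 * ‖x‖ ^ 2 + -‖y‖ ^ 2 / 2 + -‖x‖ ^ 2 / (2 * (p - 1)) := by
    have : -‖x‖ ^ 2 / (2 * (p - 1)) = -‖x‖ ^ 2 / 2 * (q - 1) := by
      field_simp
      linear_combination ‖x‖ ^ 2 * hq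
    rw [this, sum_sq_complexPoint, norm_smul, mul_pow, Real.norm_eq_abs, sq_abs]
    simp [-Complex.ofReal_pow]
    ring
  rw [← ENNReal.ofReal_mul (Real.exp_nonneg _), ← ofReal_norm, inversionKernel, norm_mul,
    Complex.norm_exp, hre, Real.exp_add, Real.exp_add, EuclideanSpace.real_norm_sq_eq,
    EuclideanSpace.real_norm_sq_eq]
  ring_nf

theorem lintegral_enorm_inversionKernel (hpq : p.HolderConjugate q) (x : 𝔼) :
    ∫⁻ y, ‖inversionKernel q F x y‖ₑ =
      ENNReal.ofReal (Real.exp (q * (q - 1) / 2 * ‖x‖ ^ 2)) *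
        ∫⁻ y : 𝔼, ENNReal.ofReal (‖F (complexPoint x y)‖ * Real.exp (-(∑ j, y j ^ 2) / 2) *
          Real.exp (-(∑ j, x j ^ 2) / (2 * (p - 1)))) := by
  simp only [enorm_inversionKernel hpq]
  rw [lintegral_const_mul' _ _ ENNReal.ofReal_ne_top]

theorem measurable_lintegral_fibre (hF : Continuous F) :
    Measurable fun x : 𝔼 => ∫⁻ y : 𝔼, ENNReal.ofReal (‖F (complexPoint x y)‖ *
      Real.exp (-(∑ j, y j ^ 2) / 2) * Real.exp (-(∑ j, x j ^ 2) / (2 * (p - 1)))) := by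
  refine Measurable.lintegral_prod_right' (f := fun v : 𝔼 × 𝔼 => ENNReal.ofReal
    (‖F (complexPoint v.1 v.2)‖ * Real.exp (-(∑ j, v.2 j ^ 2) / 2) *
      Real.exp (-(∑ j, v.1 j ^ 2) / (2 * (p - 1))))) ?_
  have h := hF.comp (continuous_complexPoint (d := d))
  exact (Continuous.measurable ((h.norm.mul (by fun_prop)).mul (by fun_prop))).ennreal_ofReal

/-- The decay e^{-q²|x|²/2} of ρ beats the growth e^{q(q-1)|x|²/2} of the kernel, leaving
e^{-q|x|²/2} up to a linear exponent. This lies in L^q, and Hölder pairs it with the L^p fibre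
integral. -/
theorem integrable_gaussianDensityC_mul_inversionKernel (hpq : p.HolderConjugate q)
    (hF : Continuous F)
    (hint : ∫⁻ x : 𝔼, (∫⁻ y : 𝔼, ENNReal.ofReal (‖F (complexPoint x y)‖ *
      Real.exp (-(∑ j, y j ^ 2) / 2) * Real.exp (-(∑ j, x j ^ 2) / (2 * (p - 1))))) ^ p < ⊤)
    (a b : 𝔼) :
    Integrable fun v : 𝔼 × 𝔼 =>
      gaussianDensityC (complexPoint (a - q • v.1) b) * inversionKernel q F v.1 v.2 := by
  have hc : Continuous fun v : 𝔼 × 𝔼 =>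
      gaussianDensityC (complexPoint (a - q • v.1) b) * inversionKernel q F v.1 v.2 := by
    have h1 : Continuous fun v : 𝔼 × 𝔼 => complexPoint (a - q • v.1) b :=
      continuous_complexPoint.comp (f := fun v : 𝔼 × 𝔼 => (a - q • v.1, b)) (by fun_prop)
    exact (continuous_gaussianDensityC.comp h1).mul (continuous_inversionKernel hF)
  refine ⟨hc.aestronglyMeasurable, ?_⟩
  rw [hasFiniteIntegral_iff_enorm, show (volume : Measure (𝔼 × 𝔼)) = volume.prod volume from rfl,
    lintegral_prod _ hc.enorm.measurable.aemeasurable]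
  set H : 𝔼 → ENNReal := fun x => ∫⁻ y : 𝔼, ENNReal.ofReal (‖F (complexPoint x y)‖ *
      Real.exp (-(∑ j, y j ^ 2) / 2) * Real.exp (-(∑ j, x j ^ 2) / (2 * (p - 1)))) with hH
  set C : ℝ := Real.exp (‖b‖ ^ 2 / 2) * (2 * Real.pi) ^ (-(d : ℝ) / 2) *
    Real.exp (-‖a‖ ^ 2 / 2)
  have hC : 0 ≤ C := by positivity
  set A : 𝔼 → ENNReal := fun x =>
    ENNReal.ofReal (C * Real.exp (-(q / 2) * ‖x‖ ^ 2 + q * inner ℝ a x)) with hA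
  have hAm : Measurable A := (Continuous.measurable (by fun_prop)).ennreal_ofReal
  have hAH : ∀ x, ∫⁻ y : 𝔼, ‖gaussianDensityC (complexPoint (a - q • x) b) *
      inversionKernel q F x y‖ₑ = (A * H) x := fun x => by
    simp only [enorm_mul]
    rw [lintegral_const_mul' _ _ enorm_ne_top, lintegral_enorm_inversionKernel hpq, ← mul_assoc,
      Pi.mul_apply]
    congr 1
    rw [← ofReal_norm, norm_gaussianDensityC_complexPoint, gaussianDensity_eq,
      ← ENNReal.ofReal_mul (mul_nonneg (Real.exp_nonneg _) (by positivity)), hA]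
    congr 1
    simp only [C]
    rw [mul_assoc, mul_assoc, mul_assoc, mul_assoc, ← Real.exp_add, ← Real.exp_add]
    congr 3
    rw [norm_sub_sq_real, inner_smul_right, norm_smul, mul_pow, Real.norm_eq_abs, sq_abs]
    ring
  simp only [hAH]
  refine (ENNReal.lintegral_mul_le_Lp_mul_Lq volume hpq.symm hAm.aemeasurable
    (measurable_lintegral_fibre hF).aemeasurable).trans_lt ?_
  refine ENNReal.mul_lt_top (ENNReal.rpow_lt_top_of_nonneg (by simp [hpq.symm.nonneg]) ?_)
    (ENNReal.rpow_lt_top_of_nonneg (by simp [hpq.nonneg]) hint.ne)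
  have hq0 := hpq.symm.pos
  have hi := ((integrable_rexp_neg_mul_sq_norm_add (b := q * (q / 2)) (by positivity) (q * q) a
    ).const_mul (C ^ q)).lintegral_lt_top
  refine ne_of_lt (lt_of_eq_of_lt (lintegral_congr fun x => ?_) hi)
  rw [hA, ENNReal.ofReal_rpow_of_nonneg (by positivity) hq0.le,
    Real.mul_rpow hC (Real.exp_nonneg _), ← Real.exp_mul]
  ring_nf

/-- The terms in (qx)² cancel. Writing x = (z + z̄)/2, the cross term -q x·z equals -q(|z|² + z²)/2;
centring at a + ib removes what is linear in z̄, so all but the radial Gaussian is holomorphic in z.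
-/
theorem gaussianDensityC_mul_inversionKernel_add (a b x y : 𝔼) :
    gaussianDensityC (complexPoint (a - q • (x + a)) b) * inversionKernel q F (x + a) (y + b) =
      ((2 * Real.pi) ^ (-(d : ℝ) / 2) : ℝ) *
        ((Real.exp (-(q / 2) * (‖x‖ ^ 2 + ‖y‖ ^ 2)) : ℂ) *
          (Complex.exp (∑ j, ((1 - q) / 2 * complexPoint x y j ^ 2 +
            complexPoint x y j * ((1 - q) * a j + b j * Complex.I))) *
            F (complexPoint x y + complexPoint a b))) := by
  rw [gaussianDensityC, inversionKernel, complexPoint_add, Complex.ofReal_exp, mul_assoc]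
  congr 1
  rw [← mul_assoc, ← mul_assoc, ← Complex.exp_add, ← Complex.exp_add]
  congr 2
  rw [EuclideanSpace.real_norm_sq_eq, EuclideanSpace.real_norm_sq_eq]
  push_cast
  rw [← Finset.sum_add_distrib, Finset.mul_sum, ← Finset.sum_add_distrib, neg_div,
    Finset.sum_div, Finset.sum_div, ← Finset.sum_neg_distrib, ← Finset.sum_add_distrib]
  refine Finset.sum_congr rfl fun j _ => ?_
  simp [complexPoint]
  ring_nf
  rw [Complex.I_sq]
  ring

theorem segalBargmann_segalBargmannInv (hpq : p.HolderConjugate q) (hF : Differentiable ℂ F)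
    (hint : ∫⁻ x : 𝔼, (∫⁻ y : 𝔼, ENNReal.ofReal (‖F (complexPoint x y)‖ *
      Real.exp (-(∑ j, y j ^ 2) / 2) * Real.exp (-(∑ j, x j ^ 2) / (2 * (p - 1))))) ^ p < ⊤)
    (z : EuclideanSpace ℂ (Fin d)) : segalBargmann (segalBargmannInv q F) z = F z := by
  obtain ⟨a, b, rfl⟩ := exists_eq_complexPoint z
  have hq0 := hpq.symm.pos
  have hΦ := integrable_gaussianDensityC_mul_inversionKernel hpq hF.continuous hint a b
  set Φ : 𝔼 × 𝔼 → ℂ := fun v =>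
    gaussianDensityC (complexPoint (a - q • v.1) b) * inversionKernel q F v.1 v.2 with hΦdef
  set c : ℝ := (2 * Real.pi) ^ (-(d : ℝ) / 2) with hc
  have hcc : c * c * (2 * Real.pi) ^ d = 1 := by
    rw [hc, ← Real.rpow_natCast, ← Real.rpow_add Real.two_pi_pos,
      ← Real.rpow_add Real.two_pi_pos]
    ring_nf
    simp
  have hc0 : (c : ℂ) ≠ 0 := Complex.ofReal_ne_zero.2 (by positivity)
  have h1 : segalBargmann (segalBargmannInv q F) (complexPoint a b) =
      (q ^ d : ℝ) * (c * ∫ v, Φ v) := by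
    have hs := Measure.integral_comp_inv_smul_of_nonneg (volume : Measure 𝔼)
      (fun x => gaussianDensityC (complexPoint (a - q • x) b) *
        (c * ∫ y : 𝔼, inversionKernel q F x y)) hq0.le
    rw [finrank_euclideanSpace_fin, Complex.real_smul] at hs
    rw [segalBargmann]
    simp only [complexPoint_sub, sub_zero, segalBargmannInv]
    simp only [smul_inv_smul₀ hq0.ne'] at hs
    rw [hs, show (volume : Measure (𝔼 × 𝔼)) = volume.prod volume from rfl, integral_prod _ hΦ,
      ← integral_const_mul (c : ℂ)]
    congr 1
    refine integral_congr_ae (Filter.Eventually.of_forall fun x => ?_)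
    simp only [hΦdef]
    rw [mul_left_comm, ← integral_const_mul]
  set G : EuclideanSpace ℂ (Fin d) → ℂ := fun w =>
    Complex.exp (∑ j, ((1 - q) / 2 * w j ^ 2 + w j * ((1 - q) * a j + b j * Complex.I))) *
      F (w + complexPoint a b) with hG
  have hGd : Differentiable ℂ G := by fun_prop
  have hshift : ∀ v : 𝔼 × 𝔼, Φ (v + (a, b)) =
      c * ((Real.exp (-(q / 2) * (‖v.1‖ ^ 2 + ‖v.2‖ ^ 2)) : ℂ) * G (complexPoint v.1 v.2)) :=
    fun v => gaussianDensityC_mul_inversionKernel_add a b v.1 v.2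
  have : (volume : Measure (𝔼 × 𝔼)).IsAddHaarMeasure :=
    Measure.prod.instIsAddHaarMeasure volume volume
  have hΦs : Integrable fun v => Φ (v + (a, b)) := hΦ.comp_add_right _
  simp only [hshift] at hΦs
  have hGi := (integrable_const_mul_iff (isUnit_iff_ne_zero.2 hc0) _).1 hΦs
  have h2 : ∫ v, Φ v = c * (((Real.pi / (q / 2)) ^ d : ℝ) * F (complexPoint a b)) := by
    rw [← integral_add_right_eq_self Φ (a, b)]
    simp only [hshift]
    rw [integral_const_mul, integral_eq_of_gaussian_mul_differentiable (by positivity) hGd hGi]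
    simp [hG]
  -- The Jacobian of u = qx, the normalisations of ρ and of the inverse, and the Gaussian mass
  -- (2π/q)^d cancel.
  have h3 : q ^ d * (c * (c * (Real.pi / (q / 2)) ^ d)) = 1 := by
    have : (2 * Real.pi) ^ d = q ^ d * (Real.pi / (q / 2)) ^ d := by
      rw [← mul_pow]
      congr 1
      field_simp
    rw [← hcc, this]
    ring
  calc _ = ((q ^ d * (c * (c * (Real.pi / (q / 2)) ^ d)) : ℝ) : ℂ) * F (complexPoint a b) := by
        rw [h1, h2]
        push_cast
        ring
    _ = _ := by rw [h3, Complex.ofReal_one, one_mul]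

theorem memLp_segalBargmannInv (hpq : p.HolderConjugate q) (hF : Continuous F)
    (hint : ∫⁻ x : 𝔼, (∫⁻ y : 𝔼, ENNReal.ofReal (‖F (complexPoint x y)‖ *
      Real.exp (-(∑ j, y j ^ 2) / 2) * Real.exp (-(∑ j, x j ^ 2) / (2 * (p - 1))))) ^ p < ⊤) :
    MemLp (segalBargmannInv q F) (ENNReal.ofReal p) (gaussianRho d) := by
  have hp0 := hpq.pos
  have hq0 := hpq.symm.pos
  set H : 𝔼 → ENNReal := fun x => ∫⁻ y : 𝔼, ENNReal.ofReal (‖F (complexPoint x y)‖ *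
      Real.exp (-(∑ j, y j ^ 2) / 2) * Real.exp (-(∑ j, x j ^ 2) / (2 * (p - 1)))) with hH
  have hHm : Measurable H := measurable_lintegral_fibre hF
  set c : ℝ := (2 * Real.pi) ^ (-(d : ℝ) / 2) with hc
  have hc0 : 0 ≤ c := by positivity
  have hm : StronglyMeasurable (segalBargmannInv q F) := by
    have h : Continuous fun v : 𝔼 × 𝔼 => inversionKernel q F (q⁻¹ • v.1) v.2 :=
      (continuous_inversionKernel hF).comp
        (f := fun v : 𝔼 × 𝔼 => (q⁻¹ • v.1, v.2)) (by fun_prop)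
    exact h.stronglyMeasurable.integral_prod_right.const_mul _
  refine ⟨hm.aestronglyMeasurable, ?_⟩
  rw [eLpNorm_lt_top_iff_lintegral_rpow_enorm_lt_top (by simpa using hp0) ENNReal.ofReal_ne_top,
    ENNReal.toReal_ofReal hp0.le, gaussianRho,
    lintegral_withDensity_eq_lintegral_mul _ measurable_ofReal_gaussianDensity
      (hm.enorm.pow_const p)]
  have hle : ∀ u : 𝔼, ((fun x : 𝔼 => ENNReal.ofReal (gaussianDensity x)) *
      fun x => ‖segalBargmannInv q F x‖ₑ ^ p) u ≤
        ENNReal.ofReal (c * c ^ p) * H (q⁻¹ • u) ^ p := fun u => by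
    have h1 : ‖segalBargmannInv q F u‖ₑ ≤
        ENNReal.ofReal (c * Real.exp (q * (q - 1) / 2 * ‖q⁻¹ • u‖ ^ 2)) * H (q⁻¹ • u) := by
      rw [segalBargmannInv, enorm_mul, ← ofReal_norm, Complex.norm_of_nonneg hc0,
        ENNReal.ofReal_mul hc0, mul_assoc]
      gcongr
      exact (enorm_integral_le_lintegral_enorm _).trans
        (lintegral_enorm_inversionKernel hpq _).le
    calc _ ≤ ENNReal.ofReal (gaussianDensity u) *
          (ENNReal.ofReal (c * Real.exp (q * (q - 1) / 2 * ‖q⁻¹ • u‖ ^ 2)) * H (q⁻¹ • u)) ^ p := by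
          simp only [Pi.mul_apply]
          gcongr
      _ = _ := by
          rw [ENNReal.mul_rpow_of_nonneg _ _ hp0.le, ← mul_assoc,
            ENNReal.ofReal_rpow_of_nonneg (by positivity) hp0.le,
            ← ENNReal.ofReal_mul (gaussianDensity_pos u).le, gaussianDensity_eq,
            Real.mul_rpow hc0 (Real.exp_nonneg _), ← Real.exp_mul, ← hc, mul_mul_mul_comm,
            ← Real.exp_add, norm_smul, mul_pow, Real.norm_eq_abs, sq_abs]
          -- Since p(q-1) = q, the fibre at u/q makes the growth of |f|^p cancel the decay of ρ
          -- exactly.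
          have : -‖u‖ ^ 2 / 2 + q * (q - 1) / 2 * (q⁻¹ ^ 2 * ‖u‖ ^ 2) * p = 0 := by
            field_simp
            linear_combination ‖u‖ ^ 2 * hpq.mul_eq_add
          rw [this, Real.exp_zero, mul_one]
  refine (lintegral_mono hle).trans_lt ?_
  have hmap : ∫⁻ u : 𝔼, H (q⁻¹ • u) ^ p =
      ENNReal.ofReal |((q⁻¹) ^ Module.finrank ℝ 𝔼)⁻¹| * ∫⁻ x, H x ^ p := by
    rw [← smul_eq_mul, ← lintegral_smul_measure,
      ← Measure.map_addHaar_smul volume (inv_ne_zero hq0.ne'),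
      lintegral_map (hHm.pow_const p) (measurable_const_smul _)]
  rw [lintegral_const_mul' _ _ ENNReal.ofReal_ne_top, hmap]
  exact ENNReal.mul_lt_top ENNReal.ofReal_lt_top (ENNReal.mul_lt_top ENNReal.ofReal_lt_top hint)

end Inversion

theorem mainTheorem6 (d : ℕ) (p : ℝ) (hp : 1 < p)
    (F : EuclideanSpace ℂ (Fin d) → ℂ) (hF : Differentiable ℂ F)
    (hint : ∫⁻ x : EuclideanSpace ℝ (Fin d),
      (∫⁻ y : EuclideanSpace ℝ (Fin d),
        ENNReal.ofReal (‖F (complexPoint x y)‖ * Real.exp (-(∑ j, y j ^ 2) / 2) *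
          Real.exp (-(∑ j, x j ^ 2) / (2 * (p - 1))))) ^ p < ⊤) :
    ∃! f : Lp ℂ (ENNReal.ofReal p) (gaussianRho d),
      ∀ z : EuclideanSpace ℂ (Fin d), segalBargmann f z = F z := by
  have hpq := Real.HolderConjugate.conjExponent hp
  have hmem := memLp_segalBargmannInv hpq hF.continuous hint
  have hS : ∀ z, segalBargmann (hmem.toLp _) z = F z := fun z =>
    (segalBargmann_congr_ae hmem.coeFn_toLp z).trans
      (segalBargmann_segalBargmannInv hpq hF hint z)
  have hp1 : 1 ≤ ENNReal.ofReal p := by simpa using hp.le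
  refine ⟨hmem.toLp _, hS, fun g hg => Lp.ext ?_⟩
  exact ae_eq_of_segalBargmann_eq ((Lp.memLp g).integrable hp1) ((Lp.memLp _).integrable hp1)
    fun z => (hg z).trans (hS z).symm
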